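/- Call a finite poset $P$ a *forest* if every element of $P$ is covered by at most one element. Let $|P|$ be its number of elements and $\operatorname{rank}(P)$ the maximum number of elements of a chain in $P$. For a labeling $w$ of $P$, i.e. a bijection $w\colon P\to\{1,\dots,n\}$ with $n=|P|$, let $\mathcal L(P,w)$ be the set of permutations $i\mapsto w(p_i)$ of $\{1,\dots,n\}$, where $p_1,\dots,p_n$ runs over the linear extensions of $P$, i.e. the listings of the elements of $P$ such that $i\le j$ whenever $p_i\le_P p_j$. The labeling $w$ is *regular* if for all $x<_P z$ and $y$ in $P$ such that $w(x)<w(y)<w(z)$ or $w(x)>w(y)>w(z)$, we have $x<_P y$ or $y<_P z$. For a permutation $\sigma$ let $\operatorname{maj}(\sigma)=\sum_{i:\,\sigma(i)>\sigma(i+1)} i$, and let $\operatorname{inv}(\sigma)$ be the number of pairs $i<j$ with $\sigma(i)>\sigma(j)$. For a real random variable $X$ with mean $\mu$ and standard deviation $\sigma>0$, put $X^*=(X-\mu)/\sigma$. **Theorem.** Let $P^{(1)},P^{(2)},\dots$ be a sequence of forests with labelings $w^{(1)},w^{(2)},\dots$ such that $$|P^{(N)}|\to\infty\qquad\text{and}\qquad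 \limsup_{N\to\infty}\frac{\operatorname{rank}(P^{(N)})}{|P^{(N)}|}<1 .$$ Let $X_N$ be the value of $\operatorname{maj}$ on a uniformly random element of $\mathcal L(P^{(N)},w^{(N)})$. Then the sequence is asymptotically normal: $X_N^*$ (which is defined for all large $N$) converges in distribution to $\mathcal N(0,1)$. If all the labelings $w^{(N)}$ are regular, the same holds with $\operatorname{inv}$ in place of $\operatorname{maj}$. -/

import Mathlib

open MeasureTheory ProbabilityTheory Filter

namespace ForestStat

/-- A poset is a forest (with the roots as maximal elements) if every element is covered by at
most one element. -/
def IsForest (P : Type*) [PartialOrder P] : Prop :=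
  ∀ x y z : P, x ⋖ y → x ⋖ z → y = z

open Classical in
/-- The rank of a finite poset: the maximum number of elements in a chain. -/
noncomputable def rank (P : Type*) [PartialOrder P] [Fintype P] : ℕ :=
  (Finset.univ.filter fun s : Finset P => IsChain (· ≤ ·) (s : Set P)).sup Finset.card

/-- A labeling of a finite poset with `n` elements is a bijection with the `n` labels.
The labels `1, …, n` are represented, in their natural order, by the elements of `Fin n`. -/
abbrev Labeling (P : Type*) [Fintype P] : Type _ :=
  P ≃ Fin (Fintype.card P)

/-- Regular labelings: if `x < z` in the poset and the label of `y` lies strictly between the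
labels of `x` and `z`, then `x < y` or `y < z` in the poset. -/
def Labeling.IsRegular {P : Type*} [PartialOrder P] [Fintype P] (w : Labeling P) : Prop :=
  ∀ x y z : P, x < z → ((w x < w y ∧ w y < w z) ∨ (w y < w x ∧ w z < w y)) → x < y ∨ y < z

/-- The set of permutations `i ↦ w (p i)`, where `p` runs over the linear extensions of the poset,
i.e. the listings `p` of its elements such that `i ≤ j` whenever `p i ≤ p j`. -/
def linExt (P : Type*) [PartialOrder P] [Fintype P] (w : Labeling P) :
    Set (Equiv.Perm (Fin (Fintype.card P))) :=
  {σ | ∃ p : Fin (Fintype.card P) ≃ P, (∀ i j, p i ≤ p j → i ≤ j) ∧ ∀ i, σ i = w (p i)}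

/-- The number of inversions of a permutation. -/
def inv {n : ℕ} (σ : Equiv.Perm (Fin n)) : ℕ :=
  (Finset.univ.filter fun ij : Fin n × Fin n => ij.1 < ij.2 ∧ σ ij.2 < σ ij.1).card

/-- The major index of a permutation: the sum of its descents. The `0`-based position `i`
is the `1`-based position `i + 1`, which is what enters the sum. -/
def maj {n : ℕ} (σ : Equiv.Perm (Fin n)) : ℕ :=
  ∑ i : Fin n, if ∃ h : (i : ℕ) + 1 < n, σ ⟨i + 1, h⟩ < σ i then (i : ℕ) + 1 else 0

instance instMeasurableSpacePerm (n : ℕ) : MeasurableSpace (Equiv.Perm (Fin n)) := ⊤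

instance instDiscreteMeasurableSpacePerm (n : ℕ) :
    DiscreteMeasurableSpace (Equiv.Perm (Fin n)) := ⟨fun _ => trivial⟩

theorem linExt_nonempty (P : Type*) [PartialOrder P] [Fintype P] (w : Labeling P) :
    (linExt P w).Nonempty := by
  classical
  let _ : Fintype (LinearExtension P) := ‹Fintype P›
  let e : Fin (Fintype.card P) ≃o LinearExtension P :=
    Fintype.orderIsoFinOfCardEq (LinearExtension P) rfl
  let p : Fin (Fintype.card P) ≃ P := e.toEquiv
  refine ⟨p.trans w, p, fun i j hij => ?_, fun i => rfl⟩
  have h : toLinearExtension (p i) ≤ toLinearExtension (p j) := toLinearExtension.monotone hij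
  exact e.le_iff_le.mp h

/-- The uniform probability measure on the linear extensions of a labeled poset. -/
noncomputable def unif (P : Type*) [PartialOrder P] [Fintype P] (w : Labeling P) :
    Measure (Equiv.Perm (Fin (Fintype.card P))) :=
  uniformOn (linExt P w)

instance instIsProbabilityMeasureUnif (P : Type*) [PartialOrder P] [Fintype P] (w : Labeling P) :
    IsProbabilityMeasure (unif P w) :=
  isProbabilityMeasure_uniformOn (Set.toFinite _) (linExt_nonempty P w)

/-- The standardization `(X - 𝔼 X) / √(Var X)` of a real random variable. -/
noncomputable def standardize {Ω : Type*} [MeasurableSpace Ω] (μ : Measure Ω) (X : Ω → ℝ) :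
    Ω → ℝ :=
  fun ω => (X ω - ∫ ω', X ω' ∂μ) / √(variance X μ)

/-- A sequence of real random variables, each on its own probability space, is asymptotically
normal if the standardized variables converge in distribution to a standard normal variable. -/
def AsymptoticallyNormal {Ω : ℕ → Type*} [∀ N, MeasurableSpace (Ω N)]
    (μ : ∀ N, Measure (Ω N)) [∀ N, IsProbabilityMeasure (μ N)] (X : ∀ N, Ω N → ℝ) : Prop :=
  TendstoInDistribution (fun N => standardize (μ N) (X N)) atTop (id : ℝ → ℝ) μ (gaussianReal 0 1)

end ForestStat

/-! Over a forest, the generating function of `maj`, and of `inv` for a regular labeling, is a power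
of `q` times a quotient of `q`-integers: `∏ [j]_q` for `j = 1, …, n` over `∏ [hook x]_q`
(`sum_maj_mul_prod_hook`, `sum_inv_mul_prod_hook`). Both come from deleting the last element of a
linear extension, a maximal element: hooks of maximal elements partition the remaining poset, so the
recursion closes by tiling an interval of exponents with blocks of hook length.

Each `[m]_q` is, up to a factor, the generating function of a uniform variable on `m` consecutive
integers. The centered characteristic function is thus a quotient of cosine averages, and `12 *
variance = ∑ j ^ 2 - ∑ hook ^ 2`. While `n * |t| ≤ 1`, each average is a Gaussian factor up to `(n *
|t|) ^ 4` in the exponent (`exists_centered_sum_eq_exp`).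

If the rank is at most `(1 - ε) * n`, the variance is at least `ε ^ 4 * n ^ 3 / 48`
(`pow_four_card_sub_rank_le`). At `t = s / √variance` the total error is then `O(1 / n)`, and Lévy's
continuity theorem concludes. -/

namespace ForestStat

/-! ### Maximal elements of lower sets -/

section Maximal

variable {P : Type*} [PartialOrder P]

open Classical in
/-- The maximal elements of a finite set. -/
noncomputable def maxl (S : Finset P) : Finset P := S.filter fun z => ∀ y ∈ S, ¬ z < y

theorem mem_maxl {S : Finset P} {z : P} : z ∈ maxl S ↔ z ∈ S ∧ ∀ y ∈ S, ¬ z < y := by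
  simp [maxl]

theorem maxl_subset (S : Finset P) : maxl S ⊆ S := fun _ h => (mem_maxl.1 h).1

open Classical in
theorem isLowerSet_erase {S : Finset P} (hS : IsLowerSet (S : Set P)) {z : P}
    (hz : z ∈ maxl S) : IsLowerSet ((S.erase z : Finset P) : Set P) := by
  intro x y hyx hx
  simp only [Finset.coe_erase, Set.mem_sdiff, Finset.mem_coe, Set.mem_singleton_iff] at hx ⊢
  refine ⟨hS hyx hx.1, ?_⟩
  rintro rfl
  exact (mem_maxl.1 hz).2 x hx.1 (lt_of_le_of_ne hyx (Ne.symm hx.2))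

theorem exists_le_maxl {S : Finset P} {x : P} (hx : x ∈ S) : ∃ z ∈ maxl S, x ≤ z := by
  obtain ⟨z, hxz, hz⟩ := S.exists_le_maximal hx
  exact ⟨z, mem_maxl.2 ⟨hz.1, fun y hy h => h.not_ge (hz.2 hy h.le)⟩, hxz⟩

end Maximal

/-! ### Hook lengths in a forest -/

section Hooks

variable {P : Type*} [PartialOrder P] [Fintype P]

open Classical in
/-- The hook length of an element of a forest: the size of the principal lower set. -/
noncomputable def hook (x : P) : ℕ := (Finset.univ.filter (· ≤ x)).card

/-- The `q`-analogue of a natural number. -/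
def qNum {R : Type*} [CommSemiring R] (q : R) (m : ℕ) : R := ∑ k ∈ Finset.range m, q ^ k

theorem qNum_add {R : Type*} [CommSemiring R] (q : R) (a b : ℕ) :
    qNum q (a + b) = qNum q a + q ^ a * qNum q b := by
  simp [qNum, Finset.sum_range_add, Finset.mul_sum, pow_add]

/-- Any two ascents from `x` start with the same cover, so induction upwards applies: principal
upper sets are chains. -/
theorem IsForest.le_or_le (hP : IsForest P) {x y z : P} (hy : x ≤ y) (hz : x ≤ z) :
    y ≤ z ∨ z ≤ y := by
  induction x using WellFoundedGT.induction with
  | ind x ih =>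
    rcases hy.eq_or_lt with rfl | hy'
    · exact .inl hz
    rcases hz.eq_or_lt with rfl | hz'
    · exact .inr hy
    obtain ⟨u, hu, huy⟩ := exists_covBy_le_of_lt hy'
    obtain ⟨v, hv, hvz⟩ := exists_covBy_le_of_lt hz'
    obtain rfl := hP x u v hu hv
    exact ih u hu.lt huy hvz

theorem eq_of_le_maxl (hP : IsForest P) {S : Finset P} {x y z : P} (hy : y ∈ maxl S)
    (hz : z ∈ maxl S) (hxy : x ≤ y) (hxz : x ≤ z) : y = z := by
  rcases hP.le_or_le hxy hxz with h | h
  · exact h.eq_of_not_lt ((mem_maxl.1 hy).2 z (mem_maxl.1 hz).1)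
  · exact (h.eq_of_not_lt ((mem_maxl.1 hz).2 y (mem_maxl.1 hy).1)).symm

-- Principal lower sets of distinct maximal elements are disjoint, since the elements above a common
-- point would be comparable; being lower, `S` contains them entirely.
open Classical in
theorem sum_hook_eq_card (hP : IsForest P) {S T : Finset P} (hS : IsLowerSet (S : Set P))
    (hT : T ⊆ maxl S) : ∑ z ∈ T, hook z = (S.filter fun x => ∃ z ∈ T, x ≤ z).card := by
  have : (S.filter fun x => ∃ z ∈ T, x ≤ z) = T.biUnion fun z => Finset.univ.filter (· ≤ z) := by
    ext x
    simp only [Finset.mem_filter, Finset.mem_biUnion, Finset.mem_univ, true_and,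
      and_iff_right_iff_imp]
    rintro ⟨z, hz, hxz⟩
    exact hS hxz (maxl_subset S (hT hz))
  rw [this, Finset.card_biUnion]
  · rfl
  · intro y hy z hz hne
    refine Finset.disjoint_left.2 fun x hx hx' => hne ?_
    exact eq_of_le_maxl hP (hT hy) (hT hz) (by simpa using hx) (by simpa using hx')

open Classical in
theorem sum_hook_maxl (hP : IsForest P) {S : Finset P} (hS : IsLowerSet (S : Set P)) :
    ∑ z ∈ maxl S, hook z = S.card := by
  rw [sum_hook_eq_card hP hS subset_rfl, Finset.filter_true_of_mem]
  exact fun x hx => exists_le_maxl hx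

end Hooks

/-! ### Tiling identities for `q`-integers -/

section Telescoping

variable {P R : Type*} [CommSemiring R] (q : R) (h w : P → ℕ)

-- Lay blocks of lengths `h z` end to end in decreasing order of `w`. The exponent is the offset of
-- the block of `z`, and the blocks tile the whole interval.
open Classical in
theorem sum_pow_mul_qNum (T : Finset P) (hw : Set.InjOn w T) :
    ∑ z ∈ T, q ^ (∑ y ∈ T with w z < w y, h y) * qNum q (h z) = qNum q (∑ z ∈ T, h z) := by
  induction T using Finset.induction_on_min_value w with
  | empty => simp [qNum]
  | insert a T ha hmin ih =>
    have hlt : ∀ x ∈ T, w a < w x := fun x hx => lt_of_le_of_ne (hmin x hx) fun he =>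
      ha (hw (by simp) (by simp [hx]) he ▸ hx)
    rw [Finset.sum_insert ha, Finset.sum_insert ha, add_comm (h a), qNum_add,
      ← ih (hw.mono (by simp)), add_comm]
    congr 1
    · refine Finset.sum_congr rfl fun z hz => ?_
      rw [Finset.filter_insert, if_neg (hlt z hz).not_gt]
    · rw [Finset.filter_insert, if_neg (lt_irrefl _), Finset.filter_true_of_mem hlt]

-- The same tiling, with the blocks of label above `a` moved from the front to the back. They have
-- total length `A`, so the tiled interval is shifted by `A`.
open Classical in
theorem sum_pow_mul_qNum_threshold (T : Finset P) (hw : Set.InjOn w T) (a : ℕ) :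
    ∑ z ∈ T, q ^ ((if a < w z then ∑ y ∈ T, h y else 0) + ∑ y ∈ T with w z < w y, h y) *
      qNum q (h z) = q ^ (∑ z ∈ T with a < w z, h z) * qNum q (∑ z ∈ T, h z) := by
  rw [← Finset.sum_filter_add_sum_filter_not T (fun z => a < w z)]
  have h1 : ∑ z ∈ T with a < w z, q ^ ((if a < w z then ∑ y ∈ T, h y else 0) +
      ∑ y ∈ T with w z < w y, h y) * qNum q (h z) =
      q ^ (∑ y ∈ T, h y) * qNum q (∑ z ∈ T with a < w z, h z) := by
    rw [← sum_pow_mul_qNum q h w _ (hw.mono (Finset.coe_subset.2 (Finset.filter_subset _ _))), Finset.mul_sum]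
    refine Finset.sum_congr rfl fun z hz => ?_
    have hz' := (Finset.mem_filter.1 hz).2
    rw [if_pos hz', pow_add, mul_assoc, Finset.filter_filter]
    congr 4
    ext y
    simp only [Finset.mem_filter]
    grind
  have h2 : ∑ z ∈ T with ¬ a < w z, q ^ ((if a < w z then ∑ y ∈ T, h y else 0) +
      ∑ y ∈ T with w z < w y, h y) * qNum q (h z) =
      q ^ (∑ z ∈ T with a < w z, h z) * qNum q (∑ z ∈ T with ¬ a < w z, h z) := by
    rw [← sum_pow_mul_qNum q h w _ (hw.mono (Finset.coe_subset.2 (Finset.filter_subset _ _))), Finset.mul_sum]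
    refine Finset.sum_congr rfl fun z hz => ?_
    have hz' := (Finset.mem_filter.1 hz).2
    rw [if_neg hz', zero_add, ← mul_assoc, ← pow_add, Finset.filter_filter]
    congr 2
    rw [← Finset.sum_filter_add_sum_filter_not (T.filter fun y => w z < w y) (fun z => a < w z),
      Finset.filter_filter, Finset.filter_filter]
    congr 2 <;> ext y <;> simp only [Finset.mem_filter] <;> grind
  rw [h1, h2, ← Finset.sum_filter_add_sum_filter_not T (fun z => a < w z) h,
    add_comm (∑ z ∈ T with a < w z, h z), qNum_add, mul_add, pow_add]
  conv_rhs => rw [← mul_assoc, ← pow_add, add_comm (∑ z ∈ T with a < w z, h z), pow_add]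
  rw [add_comm]

end Telescoping

/-! ### Linear extensions as reversed lists -/

section Lists

variable {P : Type*} [PartialOrder P]

open Classical in
/-- The linear extensions of a finite subset, listed from the last element to the first. -/
noncomputable def revLinExt (S : Finset P) : Finset (List P) :=
  S.val.lists.toFinset.filter (List.Pairwise fun a b => ¬ a ≤ b)

theorem mem_revLinExt {S : Finset P} {l : List P} :
    l ∈ revLinExt S ↔ S.val = l ∧ l.Pairwise fun a b => ¬ a ≤ b := by
  simp [revLinExt, Multiset.mem_lists_iff]

theorem revLinExt_empty : revLinExt (∅ : Finset P) = {[]} := by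
  ext l
  rw [mem_revLinExt]
  cases l <;> simp [eq_comm]

open Classical in
theorem cons_mem_revLinExt {S : Finset P} {z : P} {l : List P} :
    z :: l ∈ revLinExt S ↔ z ∈ maxl S ∧ l ∈ revLinExt (S.erase z) := by
  simp only [mem_revLinExt, mem_maxl, List.pairwise_cons, Finset.erase_val]
  constructor
  · rintro ⟨h1, h2, h3⟩
    have hz : z ∈ S := by rw [← Finset.mem_val, h1]; simp
    refine ⟨⟨hz, fun y hy hlt => ?_⟩, ?_, h3⟩
    · rw [← Finset.mem_val, h1] at hy
      rcases List.mem_cons.1 (Multiset.mem_coe.1 hy) with rfl | hy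
      · exact lt_irrefl _ hlt
      · exact h2 y hy hlt.le
    · rw [h1]; simp
  · rintro ⟨⟨h1, h2⟩, h3, h4⟩
    refine ⟨?_, fun y hy hle => ?_, h4⟩
    · rw [← Multiset.cons_coe, ← h3, Multiset.cons_erase h1]
    · have hy' : y ∈ S.erase z := by rw [← Finset.mem_val, Finset.erase_val, h3]; simpa using hy
      rw [Finset.mem_erase] at hy'
      exact h2 y hy'.2 (lt_of_le_of_ne hle hy'.1.symm)

-- The head of a reversed list is the last element of the extension: a maximal element of `S`, free
-- to be any of them.
open Classical in
theorem sum_revLinExt {R : Type*} [AddCommMonoid R] {S : Finset P} (hS : S.Nonempty)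
    (F : List P → R) :
    ∑ l ∈ revLinExt S, F l = ∑ z ∈ maxl S, ∑ l ∈ revLinExt (S.erase z), F (z :: l) := by
  rw [Finset.sum_sigma']
  symm
  refine Finset.sum_bij (fun x _ => x.1 :: x.2) ?_ ?_ ?_ (fun _ _ => rfl)
  · rintro ⟨z, l⟩ h
    exact cons_mem_revLinExt.2 (Finset.mem_sigma.1 h)
  · rintro ⟨z, l⟩ _ ⟨z', l'⟩ _ h
    simpa using h
  · rintro (_ | ⟨z, l⟩) h
    · simp [mem_revLinExt, hS.ne_empty] at h
    · exact ⟨⟨z, l⟩, Finset.mem_sigma.2 (cons_mem_revLinExt.1 h), rfl⟩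

theorem length_of_mem_revLinExt {S : Finset P} {l : List P} (h : l ∈ revLinExt S) :
    l.length = S.card := by
  rw [Finset.card, (mem_revLinExt.1 h).1, Multiset.coe_card]

end Lists

/-! ### Statistics of reversed words -/

section Statistics

/-- The major index of a word listed from the last letter to the first, when the letter `a` is
appended at its end. -/
def revMaj : ℕ → List ℕ → ℕ
  | _, [] => 0
  | a, b :: l => (if a < b then l.length + 1 else 0) + revMaj b l

/-- The number of inversions of a word listed from the last letter to the first. -/
def revInv : List ℕ → ℕ
  | [] => 0
  | b :: l => l.countP (fun c => b < c) + revInv l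

end Statistics

/-! ### The hook formulas for `maj` and `inv` -/

section HookFormula

variable {P : Type*} [PartialOrder P] [Fintype P] {R : Type*} [CommSemiring R]

open Classical in
/-- The major index of a labeled forest: the sum of the hook lengths at the descents. -/
noncomputable def majForest (w : P → ℕ) (S : Finset P) : ℕ :=
  ∑ x ∈ S, if ∃ y ∈ S, x ⋖ y ∧ w y < w x then hook x else 0

-- Only elements covered by `z` change role. Such a `y` becomes maximal once `z` is gone, and its
-- hook, if `w z < w y`, moves from the descent sum to the sum over maximal elements. The element
-- `z` itself contributes to neither side.
open Classical in
theorem majForest_erase (hP : IsForest P) {S : Finset P} (hS : IsLowerSet (S : Set P))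
    (w : P → ℕ) {z : P} (hz : z ∈ maxl S) :
    majForest w (S.erase z) + ∑ y ∈ maxl (S.erase z) with w z < w y, hook y =
      majForest w S + ∑ y ∈ maxl S with w z < w y, hook y := by
  have hz' := mem_maxl.1 hz
  have hmax : ∀ T : Finset P, ∑ y ∈ maxl T with w z < w y, hook y =
      ∑ y ∈ T, if (∀ u ∈ T, ¬ y < u) ∧ w z < w y then hook y else 0 := by
    intro T
    rw [maxl, Finset.filter_filter, Finset.sum_filter]
    congr!
  rw [hmax, hmax, majForest, majForest, ← Finset.sum_add_distrib, ← Finset.sum_add_distrib,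
    ← Finset.add_sum_erase S _ hz'.1]
  have hnot : ¬ ∃ y ∈ S, z ⋖ y ∧ w y < w z := fun ⟨y, hy, hzy, _⟩ => hz'.2 y hy hzy.lt
  rw [if_neg hnot, if_neg (by simp), add_zero, zero_add]
  refine Finset.sum_congr rfl fun y hy => ?_
  rw [Finset.mem_erase] at hy
  by_cases hyz : y ⋖ z
  · have h1 : ¬ ∃ u ∈ S.erase z, y ⋖ u ∧ w u < w y := by
      rintro ⟨u, hu, hyu, _⟩
      exact (Finset.mem_erase.1 hu).1 (hP y u z hyu hyz)
    have h2 : ∀ u ∈ S.erase z, ¬ y < u := by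
      intro u hu hyu
      rw [Finset.mem_erase] at hu
      obtain ⟨v, hv, hvu⟩ := exists_covBy_le_of_lt hyu
      obtain rfl := hP y v z hv hyz
      exact hz'.2 u hu.2 (lt_of_le_of_ne hvu hu.1.symm)
    have h3 : ¬ ((∀ u ∈ S, ¬ y < u) ∧ w z < w y) := fun h => h.1 z hz'.1 hyz.lt
    have h4 : (∃ u ∈ S, y ⋖ u ∧ w u < w y) ↔ w z < w y := by
      constructor
      · rintro ⟨u, _, hyu, h⟩
        rwa [hP y z u hyz hyu]
      · exact fun h => ⟨z, hz'.1, hyz, h⟩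
    rw [if_neg h1, if_neg h3, zero_add, add_zero]
    simp only [h4, and_iff_right h2]
  · have h1 : (∃ u ∈ S.erase z, y ⋖ u ∧ w u < w y) ↔ ∃ u ∈ S, y ⋖ u ∧ w u < w y := by
      constructor
      · rintro ⟨u, hu, h⟩
        exact ⟨u, Finset.mem_of_mem_erase hu, h⟩
      · rintro ⟨u, hu, h⟩
        exact ⟨u, Finset.mem_erase.2 ⟨by rintro rfl; exact hyz h.1, hu⟩, h⟩
    have h2 : (∀ u ∈ S.erase z, ¬ y < u) ↔ ∀ u ∈ S, ¬ y < u := by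
      refine ⟨fun h u hu hyu => ?_, fun h u hu => h u (Finset.mem_of_mem_erase hu)⟩
      obtain ⟨v, hv, hvu⟩ := exists_covBy_le_of_lt hyu
      exact h v (Finset.mem_erase.2 ⟨by rintro rfl; exact hyz hv, hS hvu hu⟩) hv.lt
    simp only [h1, h2]

/-- The appended letter `a` makes the induction close: after `z` is removed from the end, `w z`
takes the role of `a` for the rest. `majForest_erase` rewrites the resulting exponent in terms of
`S`, and the shifted tiling sums over `z`. -/
theorem sum_revMaj_mul_prod_hook (hP : IsForest P) (q : R) {w : P → ℕ}
    (hw : Function.Injective w) (n : ℕ) {S : Finset P} (hn : S.card = n)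
    (hS : IsLowerSet (S : Set P)) (a : ℕ) :
    (∑ l ∈ revLinExt S, q ^ revMaj a (l.map w)) * ∏ x ∈ S, qNum q (hook x) =
      q ^ (majForest w S + ∑ z ∈ maxl S with a < w z, hook z) *
        ∏ j ∈ Finset.range n, qNum q (j + 1) := by
  classical
  induction n generalizing S a with
  | zero =>
    obtain rfl := Finset.card_eq_zero.1 hn
    simp [revLinExt_empty, revMaj, majForest, maxl]
  | succ n ih =>
    rw [sum_revLinExt (Finset.card_pos.1 (by omega)), Finset.sum_mul, Finset.prod_range_succ]
    have key : ∀ z ∈ maxl S, (∑ l ∈ revLinExt (S.erase z), q ^ revMaj a ((z :: l).map w)) *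
        ∏ x ∈ S, qNum q (hook x) = (q ^ majForest w S * ∏ j ∈ Finset.range n, qNum q (j + 1)) *
        (q ^ ((if a < w z then ∑ y ∈ maxl S, hook y else 0) + ∑ y ∈ maxl S with w z < w y, hook y) *
          qNum q (hook z)) := by
      intro z hz
      have hzS := maxl_subset S hz
      have hc : (S.erase z).card = n := by rw [Finset.card_erase_of_mem hzS, hn]; rfl
      have h1 : ∑ l ∈ revLinExt (S.erase z), q ^ revMaj a ((z :: l).map w) =
          q ^ (if a < w z then ∑ y ∈ maxl S, hook y else 0) *
            ∑ l ∈ revLinExt (S.erase z), q ^ revMaj (w z) (l.map w) := by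
        rw [Finset.mul_sum]
        refine Finset.sum_congr rfl fun l hl => ?_
        -- A descent from `z` to `a` sits at position `S.card`, which is the total hook length of
        -- the maximal elements.
        rw [List.map_cons, revMaj, List.length_map, length_of_mem_revLinExt hl, hc, pow_add,
          sum_hook_maxl hP hS, hn]
      have h2 := ih hc (isLowerSet_erase hS hz) (w z)
      rw [majForest_erase hP hS w hz] at h2
      rw [h1, ← Finset.mul_prod_erase S _ hzS, pow_add (n := Finset.sum _ _)]
      calc _ = q ^ (if a < w z then ∑ y ∈ maxl S, hook y else 0) * qNum q (hook z) *
          ((∑ l ∈ revLinExt (S.erase z), q ^ revMaj (w z) (l.map w)) *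
            ∏ x ∈ S.erase z, qNum q (hook x)) := by ring
        _ = _ := by rw [h2, pow_add]; ring
    rw [Finset.sum_congr rfl key, ← Finset.mul_sum,
      sum_pow_mul_qNum_threshold q hook w _ hw.injOn a, sum_hook_maxl hP hS, hn, pow_add]
    ring

open Classical in
/-- The number of inversions of a labeled forest. -/
noncomputable def invForest (w : P → ℕ) (S : Finset P) : ℕ :=
  ∑ y ∈ S, (S.filter fun x => x < y ∧ w y < w x).card

-- Letters exceeding `w z` either lie below `z`, giving forest inversions at `z`, or do not. By
-- regularity the latter are exactly the elements below some maximal `y` with `w z < w y`, which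
-- hooks count.
open Classical in
theorem invForest_erase (hP : IsForest P) {S : Finset P} (hS : IsLowerSet (S : Set P))
    {w : P → ℕ} (hw : Function.Injective w)
    (hreg : ∀ x y z : P, x < z → ((w x < w y ∧ w y < w z) ∨ (w y < w x ∧ w z < w y)) →
      x < y ∨ y < z) {z : P} (hz : z ∈ maxl S) :
    (S.filter fun x => w z < w x).card + invForest w (S.erase z) =
      invForest w S + ∑ y ∈ maxl S with w z < w y, hook y := by
  have hz' := mem_maxl.1 hz
  have h1 : invForest w S = (S.filter fun x => x < z ∧ w z < w x).card +
      invForest w (S.erase z) := by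
    rw [invForest, ← Finset.add_sum_erase S _ hz'.1, invForest]
    congr 1
    refine Finset.sum_congr rfl fun y hy => ?_
    congr 1
    ext x
    simp only [Finset.mem_filter, Finset.mem_erase]
    refine ⟨fun h => ⟨⟨?_, h.1⟩, h.2⟩, fun h => ⟨h.1.2, h.2⟩⟩
    rintro rfl
    exact hz'.2 y (Finset.mem_of_mem_erase hy) h.2.1
  rw [h1, sum_hook_eq_card hP hS (Finset.filter_subset _ _), add_right_comm]
  congr 1
  rw [← Finset.card_filter_add_card_filter_not (s := S.filter fun x => w z < w x) (fun x => x < z),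
    Finset.filter_filter, Finset.filter_filter]
  congr 2
  · ext x
    simp only [Finset.mem_filter, and_comm]
  · ext x
    simp only [Finset.mem_filter]
    refine and_congr_right fun hx => ⟨fun ⟨h2, h3⟩ => ?_, fun ⟨y, ⟨hy, h2⟩, hxy⟩ => ?_⟩
    · obtain ⟨y, hy, hxy⟩ := exists_le_maxl hx
      refine ⟨y, ⟨hy, ?_⟩, hxy⟩
      by_contra h4
      have hyz : y ≠ z := by
        rintro rfl
        rcases hxy.eq_or_lt with rfl | h
        · exact lt_irrefl _ h2
        · exact h3 h
      have h5 : w y < w z := lt_of_le_of_ne (not_lt.1 h4) fun h => hyz (hw h)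
      have hxy' : x < y := lt_of_le_of_ne hxy (by rintro rfl; omega)
      -- The label of `z` would lie between those of `x` and `y`, forcing `x < z` or `z < y`.
      rcases hreg x z y hxy' (.inr ⟨h2, h5⟩) with h | h
      · exact h3 h
      · exact hz'.2 y (maxl_subset S hy) h
    · have hyz : y ≠ z := by rintro rfl; exact lt_irrefl _ h2
      have hxz : ¬ x < z := fun h => hyz (eq_of_le_maxl hP hy hz hxy h.le)
      refine ⟨?_, hxz⟩
      by_contra h4
      have hxz' : x ≠ z := by
        rintro rfl
        exact hyz (hxy.eq_of_not_lt (hz'.2 y (maxl_subset S hy))).symm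
      have h5 : w x < w z := lt_of_le_of_ne (not_lt.1 h4) fun h => hxz' (hw h)
      have hxy' : x < y := lt_of_le_of_ne hxy (by rintro rfl; omega)
      rcases hreg x z y hxy' (.inl ⟨h5, h2⟩) with h | h
      · exact hxz h
      · exact hz'.2 y (maxl_subset S hy) h

/-- Removing the last letter loses a number of inversions independent of the order of the rest, so
no appended letter is needed and the unshifted tiling suffices. -/
theorem sum_revInv_mul_prod_hook (hP : IsForest P) (q : R) {w : P → ℕ}
    (hw : Function.Injective w)
    (hreg : ∀ x y z : P, x < z → ((w x < w y ∧ w y < w z) ∨ (w y < w x ∧ w z < w y)) →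
      x < y ∨ y < z) (n : ℕ) {S : Finset P} (hn : S.card = n) (hS : IsLowerSet (S : Set P)) :
    (∑ l ∈ revLinExt S, q ^ revInv (l.map w)) * ∏ x ∈ S, qNum q (hook x) =
      q ^ invForest w S * ∏ j ∈ Finset.range n, qNum q (j + 1) := by
  classical
  induction n generalizing S with
  | zero =>
    obtain rfl := Finset.card_eq_zero.1 hn
    simp [revLinExt_empty, revInv, invForest]
  | succ n ih =>
    rw [sum_revLinExt (Finset.card_pos.1 (by omega)), Finset.sum_mul, Finset.prod_range_succ]
    have key : ∀ z ∈ maxl S, (∑ l ∈ revLinExt (S.erase z), q ^ revInv ((z :: l).map w)) *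
        ∏ x ∈ S, qNum q (hook x) = (q ^ invForest w S * ∏ j ∈ Finset.range n, qNum q (j + 1)) *
        (q ^ (∑ y ∈ maxl S with w z < w y, hook y) * qNum q (hook z)) := by
      intro z hz
      have hzS := maxl_subset S hz
      have hc : (S.erase z).card = n := by rw [Finset.card_erase_of_mem hzS, hn]; rfl
      have h1 : ∑ l ∈ revLinExt (S.erase z), q ^ revInv ((z :: l).map w) =
          q ^ (S.filter fun x => w z < w x).card *
            ∑ l ∈ revLinExt (S.erase z), q ^ revInv (l.map w) := by
        rw [Finset.mul_sum]
        refine Finset.sum_congr rfl fun l hl => ?_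
        rw [List.map_cons, revInv, pow_add]
        congr 2
        have h3 : (S.filter fun x => w z < w x) = (S.erase z).filter fun x => w z < w x := by
          ext x
          simp only [Finset.mem_filter, Finset.mem_erase]
          refine ⟨fun h => ⟨⟨?_, h.1⟩, h.2⟩, fun h => ⟨h.1.2, h.2⟩⟩
          rintro rfl
          exact lt_irrefl _ h.2
        rw [h3, List.countP_map, Finset.card, Finset.filter_val, (mem_revLinExt.1 hl).1,
          Multiset.filter_coe, Multiset.coe_card, List.countP_eq_length_filter]
        rfl
      have h2 := ih hc (isLowerSet_erase hS hz)
      rw [h1, ← Finset.mul_prod_erase S _ hzS]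
      calc _ = q ^ (S.filter fun x => w z < w x).card * qNum q (hook z) *
          ((∑ l ∈ revLinExt (S.erase z), q ^ revInv (l.map w)) *
            ∏ x ∈ S.erase z, qNum q (hook x)) := by ring
        _ = q ^ ((S.filter fun x => w z < w x).card + invForest w (S.erase z)) *
          (qNum q (hook z) * ∏ j ∈ Finset.range n, qNum q (j + 1)) := by rw [h2, pow_add]; ring
        _ = _ := by rw [invForest_erase hP hS hw hreg hz, pow_add]; ring
    rw [Finset.sum_congr rfl key, ← Finset.mul_sum,
      sum_pow_mul_qNum q hook w _ hw.injOn, sum_hook_maxl hP hS, hn]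
    ring

end HookFormula

/-! ### From permutations to words -/

section Words

/-- The word of a permutation, listed from the last letter to the first. -/
def revWord {n : ℕ} (σ : Equiv.Perm (Fin n)) : List ℕ := (List.ofFn fun i => (σ i : ℕ)).reverse

theorem revMaj_map_range (g : ℕ → ℕ) (n : ℕ) :
    revMaj (g n) ((List.range n).reverse.map g) =
      ∑ i ∈ Finset.range n, if g (i + 1) < g i then i + 1 else 0 := by
  induction n with
  | zero => simp [revMaj]
  | succ n ih =>
    rw [List.range_succ, List.reverse_append, List.reverse_singleton, List.singleton_append,
      List.map_cons, revMaj, ih, Finset.sum_range_succ, add_comm]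
    simp

theorem revInv_map_range (g : ℕ → ℕ) (n : ℕ) :
    revInv ((List.range n).reverse.map g) =
      ∑ i ∈ Finset.range n, ∑ j ∈ Finset.range i, if g i < g j then 1 else 0 := by
  have hcount : ∀ (p : ℕ → Bool) (m : ℕ), (List.range m).countP p =
      ∑ j ∈ Finset.range m, if p j then 1 else 0 := by
    intro p m
    induction m with
    | zero => simp
    | succ m ih => rw [List.range_succ, List.countP_append, ih, Finset.sum_range_succ]; simp
  induction n with
  | zero => simp [revInv]
  | succ n ih =>
    rw [List.range_succ, List.reverse_append, List.reverse_singleton, List.singleton_append,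
      List.map_cons, revInv, ih, Finset.sum_range_succ, add_comm, List.countP_map,
      List.countP_reverse, hcount]
    simp

/-- The letters of a permutation as a function on the natural numbers, with a last letter that
exceeds all the others. -/
def letter {n : ℕ} (σ : Equiv.Perm (Fin n)) (i : ℕ) : ℕ := if h : i < n then σ ⟨i, h⟩ else n

theorem letter_fin {n : ℕ} (σ : Equiv.Perm (Fin n)) (i : Fin n) : letter σ i = σ i := by
  simp [letter]

theorem revWord_eq {n : ℕ} (σ : Equiv.Perm (Fin n)) :
    revWord σ = (List.range n).reverse.map (letter σ) := by
  rw [revWord, List.map_reverse]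
  congr 1
  refine List.ext_getElem (by simp) fun i h _ => ?_
  have : i < n := by simpa using h
  simp [letter, this]

theorem maj_eq {n : ℕ} (σ : Equiv.Perm (Fin n)) : maj σ = revMaj n (revWord σ) := by
  have h : letter σ n = n := by simp [letter]
  have := revMaj_map_range (letter σ) n
  rw [h, ← revWord_eq, Finset.sum_range] at this
  rw [this, maj]
  refine Finset.sum_congr rfl fun i _ => ?_
  congr 1
  rw [letter_fin, eq_iff_iff]
  by_cases hi : (i : ℕ) + 1 < n
  · simp [letter, hi]
  · have := (σ i).isLt
    -- At the last position the next letter is the appended `n`, which exceeds every letter and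
    -- creates no descent.
    simp only [letter, hi, dif_neg, not_false_eq_true, IsEmpty.exists_iff, false_iff, not_lt]
    omega

theorem inv_eq {n : ℕ} (σ : Equiv.Perm (Fin n)) : inv σ = revInv (revWord σ) := by
  rw [revWord_eq, revInv_map_range, Finset.sum_range, inv, Finset.card_filter,
    ← Finset.univ_product_univ, Finset.sum_product_right]
  refine Finset.sum_congr rfl fun i _ => ?_
  have : Finset.range i = (Finset.range n).filter (· < (i : ℕ)) := by
    ext j
    have := i.isLt
    simp only [Finset.mem_range, Finset.mem_filter]
    omega
  rw [this, Finset.sum_filter, Finset.sum_range]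
  refine Finset.sum_congr rfl fun j _ => ?_
  simp only [letter_fin, Fin.lt_def]
  split_ifs <;> simp_all

end Words

/-! ### From words of linear extensions to `linExt` -/

section Transfer

variable {P : Type*} [PartialOrder P] [Fintype P]

theorem mem_linExt_iff {w : Labeling P} {σ : Equiv.Perm (Fin (Fintype.card P))} :
    σ ∈ linExt P w ↔ ∀ i j, w.symm (σ i) ≤ w.symm (σ j) → i ≤ j := by
  constructor
  · rintro ⟨p, hp, h⟩ i j hij
    rw [h, h, Equiv.symm_apply_apply, Equiv.symm_apply_apply] at hij
    exact hp i j hij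
  · exact fun h => ⟨σ.trans w.symm, h, fun i => by simp⟩

open Classical in
theorem sum_linExt_eq {M : Type*} [AddCommMonoid M] (w : Labeling P) (G : List ℕ → M) :
    ∑ σ ∈ (linExt P w).toFinset, G (revWord σ) =
      ∑ l ∈ revLinExt (Finset.univ : Finset P), G (l.map fun x => (w x : ℕ)) := by
  refine Finset.sum_bij (fun σ _ => (List.ofFn fun i => w.symm (σ i)).reverse) ?_ ?_ ?_ ?_
  · intro σ hσ
    rw [Set.mem_toFinset, mem_linExt_iff] at hσ
    rw [mem_revLinExt, List.pairwise_reverse, List.pairwise_ofFn]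
    refine ⟨?_, fun i j hij h => (hσ _ _ h).not_gt hij⟩
    refine (Multiset.Nodup.ext Finset.univ.nodup ?_).2 fun x => ?_
    · rw [Multiset.coe_nodup, List.nodup_reverse, List.nodup_ofFn]
      exact w.symm.injective.comp σ.injective
    · simpa using ⟨σ.symm (w x), by simp⟩
  · intro σ _ τ _ h
    ext i
    have := congrFun (List.ofFn_injective (List.reverse_injective h)) i
    rw [w.symm.injective this]
  · intro l hl
    rw [mem_revLinExt] at hl
    have hmem : ∀ x, x ∈ l.reverse := fun x => by
      rw [List.mem_reverse, ← Multiset.mem_coe, ← hl.1]; simp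
    have hnd : l.reverse.Nodup := by
      rw [List.nodup_reverse, ← Multiset.coe_nodup, ← hl.1]; exact Finset.univ.nodup
    have hlen : l.reverse.length = Fintype.card P := by
      rw [List.length_reverse, ← Multiset.coe_card, ← hl.1]; rfl
    let p : Fin (Fintype.card P) ≃ P :=
      (finCongr hlen.symm).trans (hnd.getEquivOfForallMemList l.reverse hmem)
    have hp : List.ofFn p = l.reverse := by
      refine List.ext_getElem (by simpa using hlen.symm) fun i _ _ => ?_
      simp [p]
    refine ⟨p.trans w, ?_, ?_⟩
    · rw [Set.mem_toFinset, mem_linExt_iff]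
      intro i j hij
      have h2 := hl.2
      rw [← List.reverse_reverse l, ← hp, List.pairwise_reverse, List.pairwise_ofFn] at h2
      by_contra! hlt
      exact h2 hlt (by simpa using hij)
    · simp [hp]
  · intro σ _
    rw [revWord, List.map_reverse, List.map_ofFn]
    congr 3
    ext i
    simp

open Classical in
theorem sum_maj_mul_prod_hook (hP : IsForest P) (w : Labeling P) {R : Type*} [CommSemiring R]
    (q : R) : ∃ c : ℕ, (∑ σ ∈ (linExt P w).toFinset, q ^ maj σ) * ∏ x : P, qNum q (hook x) =
      q ^ c * ∏ j ∈ Finset.range (Fintype.card P), qNum q (j + 1) := by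
  have hw : Function.Injective fun x => (w x : ℕ) := Fin.val_injective.comp w.injective
  have := sum_revMaj_mul_prod_hook hP q hw _ (S := Finset.univ) rfl
    (by simpa using isLowerSet_univ) (Fintype.card P)
  rw [← sum_linExt_eq w fun l => q ^ revMaj (Fintype.card P) l] at this
  simp only [← maj_eq] at this
  exact ⟨_, this⟩

open Classical in
theorem sum_inv_mul_prod_hook (hP : IsForest P) {w : Labeling P} (hreg : w.IsRegular)
    {R : Type*} [CommSemiring R] (q : R) :
    ∃ c : ℕ, (∑ σ ∈ (linExt P w).toFinset, q ^ inv σ) * ∏ x : P, qNum q (hook x) =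
      q ^ c * ∏ j ∈ Finset.range (Fintype.card P), qNum q (j + 1) := by
  have hw : Function.Injective fun x => (w x : ℕ) := Fin.val_injective.comp w.injective
  have := sum_revInv_mul_prod_hook hP q hw (fun x y z => hreg x y z) _ (S := Finset.univ) rfl
    (by simpa using isLowerSet_univ)
  rw [← sum_linExt_eq w fun l => q ^ revInv l] at this
  simp only [← inv_eq] at this
  exact ⟨_, this⟩

end Transfer

/-! ### Lower bound for the variance in terms of the rank -/

section HookBounds

variable {P : Type*} [PartialOrder P] [Fintype P]

theorem hook_pos (x : P) : 0 < hook x :=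
  Finset.card_pos.2 ⟨x, by simp⟩

theorem hook_le_card (x : P) : hook x ≤ Fintype.card P :=
  Finset.card_le_univ _

theorem exists_linear_listing (P : Type*) [PartialOrder P] [Fintype P] :
    ∃ p : Fin (Fintype.card P) ≃ P, ∀ i j, p i ≤ p j → i ≤ j := by
  obtain ⟨_, p, hp, _⟩ := linExt_nonempty P (Fintype.equivFin P)
  exact ⟨p, hp⟩

theorem hook_le_of_listing {p : Fin (Fintype.card P) ≃ P} (hp : ∀ i j, p i ≤ p j → i ≤ j)
    (i : Fin (Fintype.card P)) : hook (p i) ≤ i + 1 := by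
  classical
  calc hook (p i) ≤ (Finset.Iic i).card := by
        refine Finset.card_le_card_of_injOn p.symm (fun y hy => ?_) p.symm.injective.injOn
        have hy' : y ≤ p i := by simpa using hy
        simpa using hp (p.symm y) i (by simpa using hy')
    _ = i + 1 := Fin.card_Iic i

open Classical in
/-- The size of the principal upper set of an element. -/
noncomputable def depth (x : P) : ℕ := (Finset.univ.filter (x ≤ ·)).card

theorem depth_le_of_listing {p : Fin (Fintype.card P) ≃ P} (hp : ∀ i j, p i ≤ p j → i ≤ j)
    (i : Fin (Fintype.card P)) : depth (p i) ≤ Fintype.card P - i := by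
  classical
  calc depth (p i) ≤ (Finset.Ici i).card := by
        refine Finset.card_le_card_of_injOn p.symm (fun y hy => ?_) p.symm.injective.injOn
        have hy' : p i ≤ y := by simpa using hy
        simpa using hp i (p.symm y) (by simpa using hy')
    _ = Fintype.card P - i := Fin.card_Ici i

theorem depth_le_rank (hP : IsForest P) (x : P) : depth x ≤ rank P := by
  classical
  unfold rank depth
  convert Finset.le_sup (f := Finset.card) (b := Finset.univ.filter (x ≤ ·)) ?_
  simp only [Finset.mem_filter, Finset.mem_univ, true_and]
  intro y hy z hz _
  exact hP.le_or_le (x := x) (by simpa using hy) (by simpa using hz)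

theorem rank_le_card (P : Type*) [PartialOrder P] [Fintype P] : rank P ≤ Fintype.card P :=
  Finset.sup_le fun s _ => s.card_le_univ

theorem sum_hook_eq_sum_depth : ∑ x : P, hook x = ∑ x : P, depth x := by
  classical
  have := Finset.sum_card_bipartiteAbove_eq_sum_card_bipartiteBelow
    (s := (Finset.univ : Finset P)) (t := Finset.univ) (fun a b : P => a ≤ b)
  simp only [Finset.bipartiteAbove, Finset.bipartiteBelow] at this
  unfold hook depth
  convert this.symm

/-- With `m = n - r`, the nonzero terms are `1, …, m`. -/
theorem sq_sub_le_two_mul_sum_max {n r : ℕ} (h : r ≤ n) :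
    ((n : ℝ) - r) ^ 2 ≤ 2 * ∑ k ∈ Finset.range n, max ((k : ℝ) + 1 - r) 0 := by
  induction n, h using Nat.le_induction with
  | base =>
    rw [sub_self]
    have : 0 ≤ ∑ k ∈ Finset.range r, max ((k : ℝ) + 1 - r) 0 :=
      Finset.sum_nonneg fun _ _ => le_max_right _ _
    linarith
  | succ n h ih =>
    have h1 : (r : ℝ) ≤ n := by exact_mod_cast h
    have h2 := le_max_left ((n : ℝ) + 1 - r) 0
    rw [Finset.sum_range_succ]
    push_cast
    nlinarith

/-- Counting pairs `x ≤ y` both ways trades hooks for depths. A depth is at most the rank, and at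
most the position counted from the end of a linear extension. -/
theorem sq_card_sub_rank_le (hP : IsForest P) :
    ((Fintype.card P : ℝ) - rank P) ^ 2 ≤
      2 * (∑ j ∈ Finset.range (Fintype.card P), ((j : ℝ) + 1) - ∑ x : P, (hook x : ℝ)) := by
  obtain ⟨p, hp⟩ := exists_linear_listing P
  refine (sq_sub_le_two_mul_sum_max (rank_le_card P)).trans ?_
  have h1 : ∑ x : P, (hook x : ℝ) = ∑ x : P, (depth x : ℝ) := by
    exact_mod_cast sum_hook_eq_sum_depth (P := P)
  rw [h1, ← p.sum_comp, ← Equiv.sum_comp Fin.revPerm (fun i => (depth (p i) : ℝ)), Finset.sum_range, Finset.sum_range,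
    ← Finset.sum_sub_distrib]
  refine mul_le_mul_of_nonneg_left (Finset.sum_le_sum fun i _ => ?_) zero_le_two
  have h2 : depth (p (Fin.revPerm i)) ≤ (i : ℕ) + 1 := by
    refine (depth_le_of_listing hp _).trans ?_
    rw [Fin.revPerm_apply, Fin.val_rev]
    omega
  have h2' : (depth (p (Fin.revPerm i)) : ℝ) ≤ i + 1 := by exact_mod_cast h2
  have h3 : (depth (p (Fin.revPerm i)) : ℝ) ≤ rank P := by exact_mod_cast depth_le_rank hP _
  exact max_le (by linarith) (by linarith)

/-- Cauchy–Schwarz passes from the gap of first powers to squared gaps, and `(a - b) ^ 2 ≤ a ^ 2 - b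
^ 2` for `0 ≤ b ≤ a`, applied with `a = i + 1` and `b` the hook at position `i`. -/
theorem pow_four_card_sub_rank_le (hP : IsForest P) :
    ((Fintype.card P : ℝ) - rank P) ^ 4 ≤ 4 * Fintype.card P *
      (∑ j ∈ Finset.range (Fintype.card P), ((j : ℝ) + 1) ^ 2 - ∑ x : P, (hook x : ℝ) ^ 2) := by
  have h0 := sq_card_sub_rank_le hP
  obtain ⟨p, hp⟩ := exists_linear_listing P
  rw [← p.sum_comp, Finset.sum_range, ← Finset.sum_sub_distrib] at h0 ⊢
  have h1 := sq_sum_le_card_mul_sum_sq (s := Finset.univ)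
    (f := fun i : Fin (Fintype.card P) => ((i : ℝ) + 1) - hook (p i))
  rw [Finset.card_univ, Fintype.card_fin] at h1
  have h2 : ∑ i : Fin (Fintype.card P), (((i : ℝ) + 1) - hook (p i)) ^ 2 ≤
      ∑ i : Fin (Fintype.card P), (((i : ℝ) + 1) ^ 2 - (hook (p i) : ℝ) ^ 2) := by
    refine Finset.sum_le_sum fun i _ => ?_
    have h3 : (hook (p i) : ℝ) ≤ i + 1 := by exact_mod_cast hook_le_of_listing hp i
    nlinarith [(hook (p i)).cast_nonneg (α := ℝ)]
  calc ((Fintype.card P : ℝ) - rank P) ^ 4 = (((Fintype.card P : ℝ) - rank P) ^ 2) ^ 2 := by ring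
    _ ≤ (2 * ∑ i : Fin (Fintype.card P), (((i : ℝ) + 1) - hook (p i))) ^ 2 :=
      pow_le_pow_left₀ (sq_nonneg _) h0 2
    _ = 4 * (∑ i : Fin (Fintype.card P), (((i : ℝ) + 1) - hook (p i))) ^ 2 := by ring
    _ ≤ 4 * (Fintype.card P * ∑ i : Fin (Fintype.card P), (((i : ℝ) + 1) - hook (p i)) ^ 2) := by
      gcongr
    _ ≤ 4 * (Fintype.card P *
        ∑ i : Fin (Fintype.card P), (((i : ℝ) + 1) ^ 2 - (hook (p i) : ℝ) ^ 2)) := by gcongr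
    _ = _ := by ring

end HookBounds

/-! ### Mean and variance from derivatives at `1` -/

section Jets

open Polynomial

/-- A polynomial whose normalized coefficients have mean `m` and variance `v`, expressed through
its derivatives at `1`. -/
structure HasMeanVar (p : ℝ[X]) (m v : ℝ) : Prop where
  eval_ne : p.eval 1 ≠ 0
  deriv : p.derivative.eval 1 = m * p.eval 1
  deriv_two : p.derivative.derivative.eval 1 = (v + m ^ 2 - m) * p.eval 1

/-- Products correspond to independent sums. With `HasMeanVar.unique`, this reads moments off a
product identity without dividing polynomials. -/
theorem HasMeanVar.mul {p q : ℝ[X]} {m v m' v' : ℝ} (hp : HasMeanVar p m v)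
    (hq : HasMeanVar q m' v') : HasMeanVar (p * q) (m + m') (v + v') where
  eval_ne := by rw [eval_mul]; exact mul_ne_zero hp.1 hq.1
  deriv := by
    simp only [derivative_mul, eval_add, eval_mul, hp.2, hq.2]
    ring
  deriv_two := by
    simp only [derivative_mul, derivative_add, eval_add, eval_mul, hp.2, hq.2, hp.3, hq.3]
    ring

theorem HasMeanVar.unique {p : ℝ[X]} {m v m' v' : ℝ} (hp : HasMeanVar p m v)
    (hp' : HasMeanVar p m' v') : m = m' ∧ v = v' := by
  have h1 := mul_right_cancel₀ hp.1 (hp.2.symm.trans hp'.2)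
  have h2 := mul_right_cancel₀ hp.1 (hp.3.symm.trans hp'.3)
  subst h1
  exact ⟨rfl, by linarith⟩

theorem HasMeanVar.prod {ι : Type*} (s : Finset ι) {p : ι → ℝ[X]} {m v : ι → ℝ}
    (h : ∀ i ∈ s, HasMeanVar (p i) (m i) (v i)) :
    HasMeanVar (∏ i ∈ s, p i) (∑ i ∈ s, m i) (∑ i ∈ s, v i) := by
  classical
  induction s using Finset.induction_on with
  | empty => constructor <;> simp
  | insert a s ha ih =>
    rw [Finset.prod_insert ha, Finset.sum_insert ha, Finset.sum_insert ha]
    exact (h a (by simp)).mul (ih fun i hi => h i (by simp [hi]))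

theorem hasMeanVar_sum_X_pow {ι : Type*} {s : Finset ι} (hs : s.Nonempty) (f : ι → ℕ) :
    HasMeanVar (∑ i ∈ s, (X : ℝ[X]) ^ f i) ((∑ i ∈ s, (f i : ℝ)) / s.card)
      ((∑ i ∈ s, (f i : ℝ) ^ 2) / s.card - ((∑ i ∈ s, (f i : ℝ)) / s.card) ^ 2) := by
  have hc : (s.card : ℝ) ≠ 0 := by exact_mod_cast hs.card_pos.ne'
  have h1 : (∑ i ∈ s, (X : ℝ[X]) ^ f i).eval 1 = s.card := by simp [eval_finsetSum]
  constructor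
  · rwa [h1]
  · rw [h1, div_mul_cancel₀ _ hc]
    simp [eval_finsetSum, derivative_X_pow]
  · have h2 : ∀ k : ℕ, (k : ℝ) * ((k - 1 : ℕ) : ℝ) = (k : ℝ) ^ 2 - k := by
      rintro (_ | k) <;> simp; ring
    rw [h1, sub_add_cancel, sub_mul, div_mul_cancel₀ _ hc, div_mul_cancel₀ _ hc,
      ← Finset.sum_sub_distrib]
    simp [eval_finsetSum, derivative_X_pow, h2]

theorem hasMeanVar_X_pow (c : ℕ) : HasMeanVar ((X : ℝ[X]) ^ c) c 0 := by
  simpa using hasMeanVar_sum_X_pow (Finset.singleton_nonempty ()) fun _ => c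

theorem sum_range_cast (m : ℕ) : ∑ k ∈ Finset.range m, (k : ℝ) = m * (m - 1) / 2 := by
  induction m with
  | zero => simp
  | succ m ih => rw [Finset.sum_range_succ, ih]; push_cast; ring

theorem sum_range_cast_sq (m : ℕ) :
    ∑ k ∈ Finset.range m, (k : ℝ) ^ 2 = m * (m - 1) * (2 * m - 1) / 6 := by
  induction m with
  | zero => simp
  | succ m ih => rw [Finset.sum_range_succ, ih]; push_cast; ring

theorem hasMeanVar_qNum {m : ℕ} (hm : 0 < m) :
    HasMeanVar (qNum (X : ℝ[X]) m) (((m : ℝ) - 1) / 2) (((m : ℝ) ^ 2 - 1) / 12) := by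
  have hm' : (m : ℝ) ≠ 0 := by exact_mod_cast hm.ne'
  have := hasMeanVar_sum_X_pow (s := Finset.range m) (by simpa using hm.ne') fun k => k
  rw [sum_range_cast, sum_range_cast_sq, Finset.card_range] at this
  unfold qNum
  convert this using 1 <;> field_simp
  ring

end Jets

/-! ### Characteristic functions of uniform variables -/

section CenteredUniform

/-- The characteristic function of the centered uniform distribution on `m` consecutive
integers. -/
noncomputable def cosMean (m : ℕ) (t : ℝ) : ℝ :=
  (∑ k ∈ Finset.range m, Real.cos (t * (k - ((m : ℝ) - 1) / 2))) / m

/-- After the mean `(m - 1) / 2` is factored out as a phase, the reflection `k ↦ m - 1 - k` cancels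
the sines. -/
theorem qNum_exp {m : ℕ} (hm : 0 < m) (t : ℝ) :
    qNum (Complex.exp (t * Complex.I)) m =
      m * Complex.exp (t * (((m : ℝ) - 1) / 2 : ℝ) * Complex.I) * cosMean m t := by
  have hm' : (m : ℂ) ≠ 0 := by exact_mod_cast hm.ne'
  have hsin : ∑ k ∈ Finset.range m, Real.sin (t * (k - ((m : ℝ) - 1) / 2)) = 0 := by
    have h := Finset.sum_range_reflect (fun k : ℕ => Real.sin (t * (k - ((m : ℝ) - 1) / 2))) m
    have h2 : ∑ k ∈ Finset.range m, Real.sin (t * ((m - 1 - k : ℕ) - ((m : ℝ) - 1) / 2)) =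
        -∑ k ∈ Finset.range m, Real.sin (t * (k - ((m : ℝ) - 1) / 2)) := by
      rw [← Finset.sum_neg_distrib]
      refine Finset.sum_congr rfl fun k hk => ?_
      have hk' := Finset.mem_range.1 hk
      rw [← Real.sin_neg, Nat.sub_sub, Nat.cast_sub (by omega)]
      push_cast
      congr 1
      ring
    rw [h2] at h
    linarith
  have h1 : ∀ k : ℕ, Complex.exp (t * Complex.I) ^ k =
      Complex.exp (t * (((m : ℝ) - 1) / 2 : ℝ) * Complex.I) *
        ((Real.cos (t * (k - ((m : ℝ) - 1) / 2)) : ℝ) +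
          (Real.sin (t * (k - ((m : ℝ) - 1) / 2)) : ℝ) * Complex.I) := by
    intro k
    rw [Complex.ofReal_cos, Complex.ofReal_sin, ← Complex.exp_mul_I, ← Complex.exp_add,
      ← Complex.exp_nat_mul]
    congr 1
    push_cast
    ring
  unfold qNum cosMean
  rw [Finset.sum_congr rfl fun k _ => h1 k, ← Finset.mul_sum, Finset.sum_add_distrib,
    ← Finset.sum_mul, ← Complex.ofReal_sum, ← Complex.ofReal_sum, hsin]
  push_cast
  field_simp
  simp

theorem abs_cosMean_sub_le {m : ℕ} (hm : 0 < m) {t : ℝ} (ht : m * |t| ≤ 1) :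
    |cosMean m t - (1 - ((m : ℝ) ^ 2 - 1) / 12 * t ^ 2 / 2)| ≤ (m * |t|) ^ 4 / 200 := by
  have hm' : (0 : ℝ) < m := by exact_mod_cast hm
  have h1 : ∑ k ∈ Finset.range m, (1 - (t * (k - ((m : ℝ) - 1) / 2)) ^ 2 / 2) =
      m * (1 - ((m : ℝ) ^ 2 - 1) / 12 * t ^ 2 / 2) := by
    have : ∀ k : ℕ, 1 - (t * (k - ((m : ℝ) - 1) / 2)) ^ 2 / 2 =
        (1 - t ^ 2 * ((m : ℝ) - 1) ^ 2 / 8) - t ^ 2 / 2 * (k : ℝ) ^ 2 +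
          t ^ 2 * ((m : ℝ) - 1) / 2 * k := fun k => by ring
    simp only [this, Finset.sum_add_distrib, Finset.sum_sub_distrib, ← Finset.mul_sum,
      Finset.sum_const, Finset.card_range, sum_range_cast, sum_range_cast_sq, nsmul_eq_mul]
    ring
  have h2 : cosMean m t - (1 - ((m : ℝ) ^ 2 - 1) / 12 * t ^ 2 / 2) =
      (∑ k ∈ Finset.range m, (Real.cos (t * (k - ((m : ℝ) - 1) / 2)) -
        (1 - (t * (k - ((m : ℝ) - 1) / 2)) ^ 2 / 2))) / m := by
    rw [Finset.sum_sub_distrib, h1, cosMean, eq_div_iff hm'.ne', sub_mul,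
      div_mul_cancel₀ _ hm'.ne', mul_comm (m : ℝ)]
  rw [h2, abs_div, Nat.abs_cast, div_le_iff₀ hm']
  refine (Finset.abs_sum_le_sum_abs _ _).trans ?_
  refine (Finset.sum_le_card_nsmul _ _ ((m * |t|) ^ 4 / 200) fun k hk => ?_).trans_eq ?_
  · have hk' : (k : ℝ) + 1 ≤ m := by exact_mod_cast Finset.mem_range.1 hk
    have hk0 : (0 : ℝ) ≤ k := k.cast_nonneg
    have h3 : |t * (k - ((m : ℝ) - 1) / 2)| ≤ m * |t| / 2 := by
      rw [abs_mul]
      have : |(k : ℝ) - ((m : ℝ) - 1) / 2| ≤ m / 2 := abs_le.2 ⟨by linarith, by linarith⟩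
      nlinarith [abs_nonneg t]
    refine (Real.cos_bound (h3.trans (by linarith))).trans ?_
    have h4 := pow_le_pow_left₀ (abs_nonneg _) h3 4
    have h5 : (m * |t| / 2) ^ 4 = (m * |t|) ^ 4 / 16 := by ring
    have h6 : 0 ≤ (m * |t|) ^ 4 := by positivity
    linarith
  · rw [Finset.card_range, nsmul_eq_mul, mul_comm]

/-- The average is `1 + x` with `|x| ≤ (m * |t|) ^ 2 / 12`, and there `x - 2 * x ^ 2 ≤ log (1 + x) ≤
x`. -/
theorem cosMean_pos_and_abs_log_le {m : ℕ} (hm : 0 < m) {t : ℝ} (ht : m * |t| ≤ 1) :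
    0 < cosMean m t ∧
      |Real.log (cosMean m t) + ((m : ℝ) ^ 2 - 1) / 12 * t ^ 2 / 2| ≤ (m * |t|) ^ 4 := by
  have h0 := abs_cosMean_sub_le hm ht
  have hm' : (1 : ℝ) ≤ m := by exact_mod_cast hm
  set u := m * |t| with hu
  have hu0 : 0 ≤ u := by positivity
  set y := ((m : ℝ) ^ 2 - 1) / 12 * t ^ 2 / 2 with hy
  have hy0 : 0 ≤ y := by
    have : 0 ≤ (m : ℝ) ^ 2 - 1 := by nlinarith
    positivity
  have hyu : y ≤ u ^ 2 / 24 := by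
    rw [hy, hu, mul_pow, sq_abs]
    nlinarith [sq_nonneg t]
  have hu2 : u ^ 2 ≤ 1 := by nlinarith
  have hu4 : u ^ 4 ≤ u ^ 2 := by nlinarith [sq_nonneg u]
  set x := cosMean m t - 1 with hx
  have hcx : cosMean m t = 1 + x := by rw [hx]; ring
  have h1 := abs_le.1 h0
  have hx1 : -(u ^ 2 / 12) ≤ x := by rw [hx]; linarith
  have hx2 : x ≤ u ^ 2 / 12 := by rw [hx]; linarith
  have hpos : 0 < 1 + x := by linarith
  have hxsq : x ^ 2 ≤ u ^ 4 / 144 := by nlinarith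
  rw [hcx] at h1 ⊢
  refine ⟨hpos, abs_le.2 ⟨?_, ?_⟩⟩
  · have h2 := Real.one_sub_inv_le_log_of_pos hpos
    have h3 : x - 2 * x ^ 2 ≤ 1 - (1 + x)⁻¹ := by
      have : 1 - (1 + x)⁻¹ = x / (1 + x) := by field_simp; ring
      rw [this, le_div_iff₀ hpos]
      nlinarith [sq_nonneg x]
    nlinarith
  · have h2 := Real.log_le_sub_one_of_pos hpos
    nlinarith

end CenteredUniform

/-! ### Consequences of the product identity -/

section QuotientOfUniforms

open Polynomial

theorem map_hook_identity {Ω ι : Type*} [Fintype ι] {L : Finset Ω} {f : Ω → ℕ} {h : ι → ℕ}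
    {c n : ℕ} (H : (∑ σ ∈ L, (X : ℕ[X]) ^ f σ) * ∏ x, qNum X (h x) =
      X ^ c * ∏ j ∈ Finset.range n, qNum X (j + 1)) {R : Type*} [CommSemiring R] (q : R) :
    (∑ σ ∈ L, q ^ f σ) * ∏ x, qNum q (h x) = q ^ c * ∏ j ∈ Finset.range n, qNum q (j + 1) := by
  simpa [qNum] using congrArg (aeval q) H

theorem prod_qNum_exp {ι : Type*} (s : Finset ι) {m : ι → ℕ} (hm : ∀ i ∈ s, 0 < m i) (t : ℝ) :
    ∏ i ∈ s, qNum (Complex.exp (t * Complex.I)) (m i) =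
      (∏ i ∈ s, (m i : ℂ)) * Complex.exp (t * (∑ i ∈ s, ((m i : ℝ) - 1) / 2 : ℝ) * Complex.I) *
        (∏ i ∈ s, cosMean (m i) t : ℝ) := by
  rw [Finset.prod_congr rfl fun i hi => qNum_exp (hm i hi) t, Finset.prod_mul_distrib,
    Finset.prod_mul_distrib, ← Complex.exp_sum]
  push_cast
  rw [Finset.mul_sum, Finset.sum_mul]

theorem exists_prod_cosMean_eq_exp {ι : Type*} (s : Finset ι) {m : ι → ℕ} {n : ℕ}
    (hm : ∀ i ∈ s, 0 < m i) (hn : ∀ i ∈ s, m i ≤ n) {t : ℝ} (ht : n * |t| ≤ 1) :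
    ∃ e : ℝ, |e| ≤ s.card * (n * |t|) ^ 4 ∧ ∏ i ∈ s, cosMean (m i) t =
      Real.exp (-((∑ i ∈ s, ((m i : ℝ) ^ 2 - 1) / 12) * t ^ 2 / 2) + e) := by
  have hmn : ∀ i ∈ s, m i * |t| ≤ n * |t| := fun i hi => by
    have : (m i : ℝ) ≤ n := by exact_mod_cast hn i hi
    gcongr
  have hc := fun i hi => cosMean_pos_and_abs_log_le (hm i hi) ((hmn i hi).trans ht)
  refine ⟨∑ i ∈ s, (Real.log (cosMean (m i) t) + ((m i : ℝ) ^ 2 - 1) / 12 * t ^ 2 / 2), ?_, ?_⟩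
  · refine (Finset.abs_sum_le_sum_abs _ _).trans ?_
    refine (Finset.sum_le_card_nsmul _ _ ((n * |t|) ^ 4) fun i hi => ?_).trans_eq
      (nsmul_eq_mul _ _)
    exact (hc i hi).2.trans (pow_le_pow_left₀ (by positivity) (hmn i hi) 4)
  · rw [Finset.sum_add_distrib, Finset.sum_mul, Finset.sum_div, neg_add_cancel_comm_assoc,
      Real.exp_sum]
    exact Finset.prod_congr rfl fun i hi => (Real.exp_log (hc i hi).1).symm

variable {Ω ι : Type*} [Fintype ι] {L : Finset Ω} {f : Ω → ℕ} {h : ι → ℕ} {c : ℕ}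

theorem mean_and_variance_of_hook_identity (hL : L.Nonempty) (hpos : ∀ x, 0 < h x)
    (H : (∑ σ ∈ L, (X : ℕ[X]) ^ f σ) * ∏ x, qNum X (h x) =
      X ^ c * ∏ j ∈ Finset.range (Fintype.card ι), qNum X (j + 1)) :
    (∑ σ ∈ L, (f σ : ℝ)) / L.card + ∑ x, ((h x : ℝ) - 1) / 2 =
        c + ∑ j ∈ Finset.range (Fintype.card ι), (((j + 1 : ℕ) : ℝ) - 1) / 2 ∧
      (∑ σ ∈ L, (f σ : ℝ) ^ 2) / L.card - ((∑ σ ∈ L, (f σ : ℝ)) / L.card) ^ 2 +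
          ∑ x, ((h x : ℝ) ^ 2 - 1) / 12 =
        ∑ j ∈ Finset.range (Fintype.card ι), (((j + 1 : ℕ) : ℝ) ^ 2 - 1) / 12 := by
  have h1 := (hasMeanVar_sum_X_pow hL f).mul
    (HasMeanVar.prod Finset.univ fun x _ => hasMeanVar_qNum (hpos x))
  rw [map_hook_identity H] at h1
  have h2 := h1.unique ((hasMeanVar_X_pow c).mul
    (HasMeanVar.prod (Finset.range (Fintype.card ι)) fun j _ => hasMeanVar_qNum j.succ_pos))
  rwa [zero_add] at h2

/-- The identity at `q = exp (i t)` is normalized by its value at `q = 1`. The phases match because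
the means do, the Gaussian factors because the variances do, and the errors of numerator and
denominator subtract. -/
theorem exists_centered_sum_eq_exp (hL : L.Nonempty) (hpos : ∀ x, 0 < h x)
    (hle : ∀ x, h x ≤ Fintype.card ι)
    (H : (∑ σ ∈ L, (X : ℕ[X]) ^ f σ) * ∏ x, qNum X (h x) =
      X ^ c * ∏ j ∈ Finset.range (Fintype.card ι), qNum X (j + 1))
    {t M v : ℝ} (ht : Fintype.card ι * |t| ≤ 1) (hM : M = (∑ σ ∈ L, (f σ : ℝ)) / L.card)
    (hv : v = (∑ σ ∈ L, (f σ : ℝ) ^ 2) / L.card - M ^ 2) :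
    ∃ e : ℝ, |e| ≤ 2 * Fintype.card ι * (Fintype.card ι * |t|) ^ 4 ∧
      (∑ σ ∈ L, Complex.exp ((t * (f σ - M) : ℝ) * Complex.I)) / L.card =
        Real.exp (-(v * t ^ 2 / 2) + e) := by
  set n := Fintype.card ι
  obtain ⟨hm1, hv1⟩ := mean_and_variance_of_hook_identity hL hpos H
  rw [← hM] at hm1 hv1
  rw [← hv] at hv1
  obtain ⟨e₁, he₁, hp₁⟩ := exists_prod_cosMean_eq_exp (Finset.range n) (m := fun j => j + 1)
    (fun j _ => j.succ_pos) (fun j hj => Finset.mem_range.1 hj) ht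
  obtain ⟨e₂, he₂, hp₂⟩ := exists_prod_cosMean_eq_exp Finset.univ (fun x _ => hpos x)
    (fun x _ => hle x) ht
  rw [Finset.card_range] at he₁
  rw [Finset.card_univ] at he₂
  refine ⟨e₁ - e₂, (abs_sub _ _).trans (by linarith), ?_⟩
  have hone := map_hook_identity H (1 : ℂ)
  simp only [qNum, one_pow, Finset.sum_const, Finset.card_range, nsmul_eq_mul, mul_one,
    one_mul] at hone
  have hL0 : (L.card : ℂ) ≠ 0 := by exact_mod_cast hL.card_pos.ne'
  have hprod : ∏ x, (h x : ℂ) ≠ 0 :=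
    Finset.prod_ne_zero_iff.2 fun x _ => by exact_mod_cast (hpos x).ne'
  have hq := map_hook_identity H (Complex.exp (t * Complex.I))
  rw [prod_qNum_exp _ (fun x _ => hpos x), prod_qNum_exp _ (fun j _ => j.succ_pos), ← hone,
    hp₁, hp₂] at hq
  have hexp : Complex.exp (t * Complex.I) ^ c *
      Complex.exp (t * (∑ j ∈ Finset.range n, (((j + 1 : ℕ) : ℝ) - 1) / 2 : ℝ) * Complex.I) =
      Complex.exp (t * M * Complex.I) *
        Complex.exp (t * (∑ x, ((h x : ℝ) - 1) / 2 : ℝ) * Complex.I) := by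
    rw [← Complex.exp_nat_mul, ← Complex.exp_add, ← Complex.exp_add]
    congr 1
    have hm2 := congrArg (fun r : ℝ => (r : ℂ)) hm1
    simp only [Complex.ofReal_add, Complex.ofReal_natCast] at hm2
    linear_combination -(t * Complex.I : ℂ) * hm2
  have hsum : ∑ σ ∈ L, Complex.exp ((t * (f σ - M) : ℝ) * Complex.I) =
      (∑ σ ∈ L, Complex.exp (t * Complex.I) ^ f σ) * (Complex.exp (t * M * Complex.I))⁻¹ := by
    rw [Finset.sum_mul]
    refine Finset.sum_congr rfl fun σ _ => ?_
    rw [← Complex.exp_nat_mul, ← Complex.exp_neg, ← Complex.exp_add]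
    congr 1
    push_cast
    ring
  have hreal : Real.exp (-(v * t ^ 2 / 2) + (e₁ - e₂)) *
      Real.exp (-((∑ x, ((h x : ℝ) ^ 2 - 1) / 12) * t ^ 2 / 2) + e₂) =
      Real.exp (-((∑ j ∈ Finset.range n, (((j + 1 : ℕ) : ℝ) ^ 2 - 1) / 12) * t ^ 2 / 2) + e₁) := by
    rw [← Real.exp_add, ← hv1]
    congr 1
    ring
  rw [← hreal, Complex.ofReal_mul] at hq
  have hE : ((Real.exp (-((∑ x, ((h x : ℝ) ^ 2 - 1) / 12) * t ^ 2 / 2) + e₂) : ℝ) : ℂ) ≠ 0 := by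
    exact_mod_cast (Real.exp_pos _).ne'
  have hcancel : (∏ x, (h x : ℂ)) *
      Complex.exp (t * (∑ x, ((h x : ℝ) - 1) / 2 : ℝ) * Complex.I) *
      ((Real.exp (-((∑ x, ((h x : ℝ) ^ 2 - 1) / 12) * t ^ 2 / 2) + e₂) : ℝ) : ℂ) ≠ 0 :=
    mul_ne_zero (mul_ne_zero hprod (Complex.exp_ne_zero _)) hE
  rw [hsum, div_eq_iff hL0, mul_inv_eq_iff_eq_mul₀ (Complex.exp_ne_zero _)]
  refine mul_right_cancel₀ hcancel (hq.trans ?_)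
  linear_combination (L.card * ∏ x, (h x : ℂ)) * (Real.exp (-(v * t ^ 2 / 2) + (e₁ - e₂)) : ℝ) *
    ((Real.exp (-((∑ x, ((h x : ℝ) ^ 2 - 1) / 12) * t ^ 2 / 2) + e₂) : ℝ) : ℂ) * hexp

end QuotientOfUniforms

/-! ### Convergence to the normal law -/

section Normality

open Polynomial Topology

open Classical in
theorem integral_unif {P : Type*} [PartialOrder P] [Fintype P] (w : Labeling P) {E : Type*}
    [NormedAddCommGroup E] [NormedSpace ℝ E] [CompleteSpace E] (g : Equiv.Perm (Fin (Fintype.card P)) → E) :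
    ∫ σ, g σ ∂(unif P w) =
      ((linExt P w).toFinset.card : ℝ)⁻¹ • ∑ σ ∈ (linExt P w).toFinset, g σ := by
  rw [integral_fintype .of_finite, Finset.smul_sum, ← Finset.sum_filter_add_sum_filter_not
    Finset.univ (· ∈ linExt P w), ← add_zero (∑ σ ∈ (linExt P w).toFinset, _)]
  have hreal : ∀ σ, (unif P w).real {σ} =
      if σ ∈ linExt P w then ((linExt P w).toFinset.card : ℝ)⁻¹ else 0 := by
    intro σ
    have h := uniformOn_apply_finset (s := (linExt P w).toFinset) (t := {σ})
    rw [Set.coe_toFinset, Finset.coe_singleton] at h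
    rw [Measure.real, unif, h]
    by_cases hσ : σ ∈ linExt P w
    · rw [Finset.inter_singleton_of_mem (by simpa using hσ)]
      simp [hσ]
    · rw [Finset.inter_singleton_of_notMem (by simpa using hσ)]
      simp [hσ]
  congr 1
  · refine Finset.sum_congr (by ext; simp) fun σ hσ => ?_
    rw [hreal, if_pos (by simpa using hσ)]
  · refine Finset.sum_eq_zero fun σ hσ => ?_
    rw [hreal, if_neg (by simpa using hσ), zero_smul]

variable {P : Type*} [PartialOrder P] [Fintype P]

-- At `t = s / √v`, the bound `v ≥ ε ^ 4 * n ^ 3 / 48` gives `(n * |t|) ^ 2 ≤ K / n` with `K = 48 *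
-- s ^ 2 / ε ^ 4`, so the error `2 * n * (n * |t|) ^ 4` is at most `2 * K ^ 2 / n`.
open Classical in
theorem exists_charFun_standardize_eq (hP : IsForest P) (w : Labeling P)
    {f : Equiv.Perm (Fin (Fintype.card P)) → ℕ}
    (H : ∃ c : ℕ, (∑ σ ∈ (linExt P w).toFinset, (X : ℕ[X]) ^ f σ) * ∏ x : P, qNum X (hook x) =
      X ^ c * ∏ j ∈ Finset.range (Fintype.card P), qNum X (j + 1))
    {ε s : ℝ} (hε : 0 < ε) (hn : 0 < Fintype.card P)
    (hr : ε * Fintype.card P ≤ Fintype.card P - rank P)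
    (hs : 48 * s ^ 2 / ε ^ 4 / Fintype.card P ≤ 1) :
    ∃ e : ℝ, |e| ≤ 2 * (48 * s ^ 2 / ε ^ 4) ^ 2 / Fintype.card P ∧
      charFun ((unif P w).map (standardize (unif P w) fun σ => (f σ : ℝ))) s =
        Real.exp (-(s ^ 2 / 2) + e) := by
  obtain ⟨c, H⟩ := H
  set L := (linExt P w).toFinset with hLdef
  have hL : L.Nonempty := Set.toFinset_nonempty.2 (linExt_nonempty P w)
  have hL0 : (L.card : ℝ) ≠ 0 := by exact_mod_cast hL.card_pos.ne'
  have hn0 : (0 : ℝ) < Fintype.card P := by exact_mod_cast hn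
  set M : ℝ := (∑ σ ∈ L, (f σ : ℝ)) / L.card with hM
  set v : ℝ := (∑ σ ∈ L, (f σ : ℝ) ^ 2) / L.card - M ^ 2 with hv
  have hmean : ∫ σ, (f σ : ℝ) ∂(unif P w) = M := by
    rw [integral_unif, hM, smul_eq_mul, div_eq_inv_mul]
  have hvar : variance (fun σ => (f σ : ℝ)) (unif P w) = v := by
    rw [variance_eq_integral (measurable_of_finite _).aemeasurable, hmean, integral_unif, ← hLdef,
      smul_eq_mul, ← div_eq_inv_mul, hv, div_sub' hL0]
    congr 1
    have hsum : ∑ σ ∈ L, (f σ : ℝ) = L.card * M := by rw [hM]; field_simp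
    simp only [sub_sq, Finset.sum_add_distrib, Finset.sum_sub_distrib, Finset.sum_const,
      nsmul_eq_mul, ← Finset.sum_mul, ← Finset.mul_sum, hsum]
    ring
  have hv12 : 12 * v = ∑ j ∈ Finset.range (Fintype.card P), ((j : ℝ) + 1) ^ 2 - ∑ x : P, (hook x : ℝ) ^ 2 := by
    have h := (mean_and_variance_of_hook_identity hL hook_pos H).2
    rw [← hM, ← hv, ← Finset.sum_div, ← Finset.sum_div, Finset.sum_sub_distrib,
      Finset.sum_sub_distrib] at h
    simp only [Finset.sum_const, Finset.card_univ, Finset.card_range, nsmul_eq_mul,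
      mul_one] at h
    push_cast at h
    linarith
  set n : ℝ := ((Fintype.card P : ℕ) : ℝ)
  have hvn : ε ^ 4 * n ^ 3 / 48 ≤ v := by
    have h1 := pow_four_card_sub_rank_le hP
    rw [← hv12] at h1
    have h2 : (ε * n) ^ 4 ≤ ((n : ℝ) - rank P) ^ 4 := pow_le_pow_left₀ (by positivity) hr 4
    have h3 : n * (ε ^ 4 * n ^ 3) ≤ n * (48 * v) := by
      calc n * (ε ^ 4 * n ^ 3) = (ε * n) ^ 4 := by ring
        _ ≤ 4 * n * (12 * v) := h2.trans h1
        _ = n * (48 * v) := by ring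
    have h4 := le_of_mul_le_mul_left h3 hn0
    linarith
  have hv0 : 0 < v := lt_of_lt_of_le (by positivity) hvn
  set K : ℝ := 48 * s ^ 2 / ε ^ 4 with hK
  have hK0 : 0 ≤ K := by positivity
  have hu : (n * |s / √v|) ^ 2 ≤ K / n := by
    rw [mul_pow, sq_abs, div_pow, Real.sq_sqrt hv0.le, ← mul_div_assoc, div_le_div_iff₀ hv0 hn0]
    calc n ^ 2 * s ^ 2 * n = K * (ε ^ 4 * n ^ 3 / 48) := by rw [hK]; field_simp
      _ ≤ K * v := by gcongr
  have ht : n * |s / √v| ≤ 1 := by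
    have h0 : 0 ≤ n * |s / √v| := by positivity
    nlinarith [hu.trans hs]
  obtain ⟨e, he, hexp⟩ := exists_centered_sum_eq_exp hL hook_pos hook_le_card H ht hM hv
  refine ⟨e, ?_, ?_⟩
  · calc |e| ≤ 2 * n * ((n * |s / √v|) ^ 2) ^ 2 := by rw [← pow_mul]; exact he
      _ ≤ 2 * n * (K / n) ^ 2 := by gcongr
      _ = 2 * K ^ 2 / n := by field_simp
  · have hsv : v * (s / √v) ^ 2 / 2 = s ^ 2 / 2 := by
      rw [div_pow, Real.sq_sqrt hv0.le]
      field_simp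
    rw [hsv] at hexp
    rw [charFun_apply_real, integral_map (measurable_of_finite _).aemeasurable (by fun_prop),
      integral_unif, ← hexp, Complex.real_smul, Complex.ofReal_inv, Complex.ofReal_natCast,
      ← div_eq_inv_mul]
    congr 1
    refine Finset.sum_congr rfl fun σ _ => ?_
    congr 1
    rw [standardize, hmean, hvar]
    push_cast
    ring

open Classical in
theorem asymptoticallyNormal_of_hook_identity (P : ℕ → Type*) [∀ N, PartialOrder (P N)]
    [∀ N, Fintype (P N)] (w : ∀ N, Labeling (P N)) (hforest : ∀ N, IsForest (P N))
    (hcard : Tendsto (fun N => Fintype.card (P N)) atTop atTop)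
    (hrank : limsup (fun N => (rank (P N) : ℝ) / (Fintype.card (P N) : ℝ)) atTop < 1)
    (f : ∀ N, Equiv.Perm (Fin (Fintype.card (P N))) → ℕ)
    (H : ∀ N, ∃ c : ℕ, (∑ σ ∈ (linExt (P N) (w N)).toFinset, (X : ℕ[X]) ^ f N σ) *
      ∏ x : P N, qNum X (hook x) =
        X ^ c * ∏ j ∈ Finset.range (Fintype.card (P N)), qNum X (j + 1)) :
    AsymptoticallyNormal (fun N => unif (P N) (w N)) (fun N σ => (f N σ : ℝ)) := by
  -- Eventually the rank ratio is below `b < 1`, so `1 - b` serves as the uniform `ε`.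
  obtain ⟨b, hb, hb1⟩ := exists_between hrank
  have hbdd : IsBoundedUnder (· ≤ ·) atTop
      fun N => (rank (P N) : ℝ) / (Fintype.card (P N) : ℝ) :=
    isBoundedUnder_of ⟨1, fun N => div_le_one_of_le₀ (by exact_mod_cast rank_le_card (P N))
      (Nat.cast_nonneg _)⟩
  have hev := eventually_lt_of_limsup_lt hb hbdd
  refine ⟨fun N => (measurable_of_finite _).aemeasurable, aemeasurable_id, ?_⟩
  refine ProbabilityMeasure.tendsto_iff_tendsto_charFun.2 fun s => ?_
  have hcardR : Tendsto (fun N => (Fintype.card (P N) : ℝ)) atTop atTop :=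
    tendsto_natCast_atTop_atTop.comp hcard
  have hexists : ∀ᶠ N in atTop, ∃ e : ℝ,
      |e| ≤ 2 * (48 * s ^ 2 / (1 - b) ^ 4) ^ 2 / Fintype.card (P N) ∧
      charFun ((unif (P N) (w N)).map
        (standardize (unif (P N) (w N)) fun σ => (f N σ : ℝ))) s =
          Real.exp (-(s ^ 2 / 2) + e) := by
    have hsmall := (hcardR.const_div_atTop (48 * s ^ 2 / (1 - b) ^ 4)).eventually_le_const
      zero_lt_one
    filter_upwards [hev, hsmall, hcard.eventually_gt_atTop 0] with N h1 h2 h3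
    refine exists_charFun_standardize_eq (hforest N) (w N) (H N) (sub_pos.2 hb1) h3 ?_ h2
    rw [div_lt_iff₀ (by exact_mod_cast h3)] at h1
    linarith
  obtain ⟨e, he⟩ := skolem.1 hexists
  have he0 : Tendsto e atTop (𝓝 0) :=
    squeeze_zero_norm' (he.mono fun N h => h.1)
      (hcardR.const_div_atTop (2 * (48 * s ^ 2 / (1 - b) ^ 4) ^ 2))
  have hlim : Tendsto (fun N => ((Real.exp (-(s ^ 2 / 2) + e N) : ℝ) : ℂ)) atTop
      (𝓝 ((Real.exp (-(s ^ 2 / 2)) : ℝ) : ℂ)) := by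
    have h1 : Tendsto (fun N => -(s ^ 2 / 2) + e N) atTop (𝓝 (-(s ^ 2 / 2))) := by
      simpa using he0.const_add (-(s ^ 2 / 2))
    exact (Complex.continuous_ofReal.tendsto _).comp ((Real.continuous_exp.tendsto _).comp h1)
  have hgauss : charFun ((gaussianReal 0 1).map id) s = ((Real.exp (-(s ^ 2 / 2)) : ℝ) : ℂ) := by
    rw [Measure.map_id, charFun_gaussianReal]
    push_cast
    congr 1
    simp
  simp only [ProbabilityMeasure.coe_mk]
  rw [hgauss]
  exact hlim.congr' (he.mono fun N h => h.2.symm)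

end Normality

end ForestStat

theorem theorem1p7 (P : ℕ → Type*) [∀ N, PartialOrder (P N)] [∀ N, Fintype (P N)]
    (w : ∀ N, ForestStat.Labeling (P N))
    (hforest : ∀ N, ForestStat.IsForest (P N))
    (hcard : Tendsto (fun N => Fintype.card (P N)) atTop atTop)
    (hrank : limsup (fun N => (ForestStat.rank (P N) : ℝ) / (Fintype.card (P N) : ℝ)) atTop < 1) :
    ForestStat.AsymptoticallyNormal (fun N => ForestStat.unif (P N) (w N))
        (fun _ σ => (ForestStat.maj σ : ℝ)) ∧
      ((∀ N, (w N).IsRegular) →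
        ForestStat.AsymptoticallyNormal (fun N => ForestStat.unif (P N) (w N))
          (fun _ σ => (ForestStat.inv σ : ℝ))) :=
  ⟨ForestStat.asymptoticallyNormal_of_hook_identity P w hforest hcard hrank _
      fun N => ForestStat.sum_maj_mul_prod_hook (hforest N) (w N) _,
    fun hreg => ForestStat.asymptoticallyNormal_of_hook_identity P w hforest hcard hrank _
      fun N => ForestStat.sum_inv_mul_prod_hook (hforest N) (hreg N) _⟩
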